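/- Let $X$ be a metric space. For a family $\mathcal U$ of subsets of $X$ and $x\in X$ let $L_{\mathcal U}(x)=\sup_{U\in\mathcal U}\operatorname{dist}(x,X\setminus U)\in[0,\infty]$ (with $\operatorname{dist}(x,\emptyset)=\infty$, and $L_{\mathcal U}\equiv 0$ for the empty family). The family $\mathcal U$ is called coarse if $L_{\mathcal U}(x)\to\infty$ as $x\to\infty$ in $X$, i.e. if for every $t<\infty$ there is a bounded set $K\subset X$ with $L_{\mathcal U}(x)>t$ for all $x\in X\setminus K$. A coarse refinement of a family $\mathcal U$ is a coarse family $\mathcal V$ such that every $V\in\mathcal V$ is contained in some $U\in\mathcal U$. The multiplicity of $\mathcal V$ is the supremum over $x\in X$ of the number of elements of $\mathcal V$ that contain $x$. The coarse dimension of $X$ is the smallest integer $n\ge -1$ such that every finite coarse family in $X$ has a coarse refinement of multiplicity at most $n+1$, and it is $\infty$ if there is no such $n$. (It is $-1$ if $X$ is bounded.) Let $A$ and $B$ be subsets of $X$, with the restricted metrics. If $X=A\cup B$, then the coarse dimension of $X$ equals the maximum of the coarse dimensions of $A$ and $B$. -/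

import Mathlib

namespace CoarseUnion

open Filter Topology

/-- The local Lebesgue number of a family `𝒰` of subsets of `X` at `x`: the supremum over
`U ∈ 𝒰` of the distance from `x` to `X \ U`, with values in `[0, ∞]`. The distance to the empty
set is `∞`, so the value is `∞` when `X ∈ 𝒰`; it is `0` for the empty family. -/
noncomputable def localLebesgue {X : Type*} [MetricSpace X] (𝒰 : Set (Set X)) (x : X) : ENNReal :=
  ⨆ U ∈ 𝒰, Metric.infEDist x Uᶜ

/-- A family of subsets is coarse if its local Lebesgue number is coarsely proper, that is, tends
to `∞` as the point goes to infinity (leaves every bounded subset of `X`). -/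
def IsCoarseFamily {X : Type*} [MetricSpace X] (𝒰 : Set (Set X)) : Prop :=
  Tendsto (localLebesgue 𝒰) (Bornology.cobounded X) (𝓝 ⊤)

/-- The number (possibly `∞`) of elements of the family `𝒰` that contain `x`. -/
noncomputable def multiplicityAt {X : Type*} (𝒰 : Set (Set X)) (x : X) : ℕ∞ :=
  {U | U ∈ 𝒰 ∧ x ∈ U}.encard

/-- The global multiplicity of the family `𝒰`. -/
noncomputable def familyMultiplicity {X : Type*} (𝒰 : Set (Set X)) : ℕ∞ :=
  ⨆ x : X, multiplicityAt 𝒰 x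

/-- `𝒱` is a coarse refinement of `𝒰`: it is a coarse family, each element of which is contained
in an element of `𝒰`. -/
def IsCoarseRefinement {X : Type*} [MetricSpace X] (𝒱 𝒰 : Set (Set X)) : Prop :=
  IsCoarseFamily 𝒱 ∧ ∀ V ∈ 𝒱, ∃ U ∈ 𝒰, V ⊆ U

/-- Every finite coarse family in `X` has a coarse refinement of multiplicity at most `n + 1`.
(Multiplicities are nonnegative, so this fails for `n < -1`.) -/
def HasCoarseDimLE (X : Type*) [MetricSpace X] (n : ℤ) : Prop :=
  ∃ k : ℕ, (k : ℤ) = n + 1 ∧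
    ∀ 𝒰 : Set (Set X), 𝒰.Finite → IsCoarseFamily 𝒰 →
      ∃ 𝒱 : Set (Set X), IsCoarseRefinement 𝒱 𝒰 ∧ familyMultiplicity 𝒱 ≤ k

/-- The coarse dimension of `X`: the smallest integer `n` such that every finite coarse family
in `X` has a coarse refinement of multiplicity at most `n + 1`, and `∞` if there is none. -/
noncomputable def coarseDim (X : Type*) [MetricSpace X] : WithTop ℤ :=
  sInf {d | ∃ n : ℤ, d = (n : WithTop ℤ) ∧ HasCoarseDimLE X n}

end CoarseUnion

namespace CoarseUnion

open Filter Topology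

/-! Coarseness means that every ball of fixed radius, centered far enough out, lies in a member. For
the union, shrink a finite family twice, keeping its index set: once to control multiplicity on `A`,
then on `B` (`exists_shrinking_on`). The second shrinking only removes points, so the bound on `A`
survives. For subspaces, a family on `A` extends to `X` by adjoining `Aᶜ`, and a refinement there is
traced back on `A`. -/

lemma ball_subset_iff_le_infEDist_compl {X : Type*} [MetricSpace X] {x : X} {r : ℝ} {U : Set X} :
    Metric.ball x r ⊆ U ↔ ENNReal.ofReal r ≤ Metric.infEDist x Uᶜ := by
  rw [Metric.le_infEDist]
  constructor
  · intro h y hy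
    by_contra! hlt
    refine hy (h ?_)
    rw [Metric.mem_ball, dist_comm]
    rw [edist_dist] at hlt
    exact (ENNReal.ofReal_lt_ofReal_iff_of_nonneg dist_nonneg).1 hlt
  · intro h y hy
    by_contra hyU
    have := h y hyU
    rw [edist_dist] at this
    rw [Metric.mem_ball, dist_comm] at hy
    exact absurd ((ENNReal.ofReal_le_ofReal_iff dist_nonneg).1 this) (not_le.2 hy)

/-- A family is coarse if and only if for every `t`, every ball of radius `t` with center
sufficiently far away lies in a member of the family. -/
lemma isCoarseFamily_iff {X : Type*} [MetricSpace X] {𝒰 : Set (Set X)} :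
    IsCoarseFamily 𝒰 ↔
      ∀ t : ℝ, ∀ᶠ x in Bornology.cobounded X, ∃ U ∈ 𝒰, Metric.ball x t ⊆ U := by
  unfold IsCoarseFamily
  rw [ENNReal.tendsto_nhds_top_iff_nnreal]
  constructor
  · intro h t
    filter_upwards [h t.toNNReal] with x hx
    simp only [localLebesgue, lt_iSup_iff] at hx
    obtain ⟨U, hU, hlt⟩ := hx
    exact ⟨U, hU, ball_subset_iff_le_infEDist_compl.2 hlt.le⟩
  · intro h t
    filter_upwards [h (t + 1)] with x ⟨U, hU, hx⟩
    refine lt_of_lt_of_le ?_ ((ball_subset_iff_le_infEDist_compl.1 hx).trans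
      (le_iSup₂ (f := fun V (_ : V ∈ 𝒰) => Metric.infEDist x Vᶜ) U hU))
    rw [← ENNReal.ofReal_coe_nnreal]
    exact (ENNReal.ofReal_lt_ofReal_iff (by positivity)).2 (by linarith)

lemma isCoarseFamily_range_iff {X ι : Type*} [MetricSpace X] {U : ι → Set X} :
    IsCoarseFamily (Set.range U) ↔
      ∀ t : ℝ, ∀ᶠ x in Bornology.cobounded X, ∃ i, Metric.ball x t ⊆ U i := by
  simp [isCoarseFamily_iff]

lemma isBounded_setOf_not {X : Type*} [Bornology X] {P : X → Prop}
    (h : ∀ᶠ x in Bornology.cobounded X, P x) : Bornology.IsBounded {x | ¬ P x} := by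
  rw [Bornology.isBounded_def]
  filter_upwards [h] with x hx hn
  exact hn hx

lemma eventually_cobounded_of_subtype {X : Type*} [MetricSpace X] {A : Set X} {P : A → Prop}
    (h : ∀ᶠ a in Bornology.cobounded A, P a) (t : ℝ) :
    ∀ᶠ x in Bornology.cobounded X, ∀ a : A, dist (a : X) x < t → P a := by
  have hb : Bornology.IsBounded ((↑) '' {a : A | ¬ P a} : Set X) := by
    rw [Bornology.isBounded_image_subtype_val]
    exact isBounded_setOf_not h
  have ht := (hb.thickening (δ := t))
  filter_upwards [Bornology.isBounded_def.1 ht] with x hx a ha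
  by_contra hPa
  exact hx (Metric.mem_thickening_iff.2 ⟨a, ⟨a, hPa, rfl⟩, by rwa [dist_comm]⟩)

lemma eventually_cobounded_subtype {X : Type*} [MetricSpace X] {A : Set X} {P : X → Prop}
    (h : ∀ᶠ x in Bornology.cobounded X, P x) : ∀ᶠ a : A in Bornology.cobounded A, P a := by
  have hb : Bornology.IsBounded {x | ¬ P x} := isBounded_setOf_not h
  have ha : Bornology.IsBounded {a : A | ¬ P a} := by
    rw [← Bornology.isBounded_image_subtype_val]
    exact hb.subset (by rintro _ ⟨a, ha, rfl⟩; exact ha)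
  have := Bornology.isBounded_def.1 ha
  filter_upwards [this] with a ha
  simpa using ha

/-- A finite coarse family can be shrunk to a coarse family such that the far away points of the
shrunken sets lie deep in the original ones. -/
lemma exists_deep_shrinking {X ι : Type*} [MetricSpace X] [Finite ι] {U : ι → Set X}
    (hU : IsCoarseFamily (Set.range U)) :
    ∃ W : ι → Set X, IsCoarseFamily (Set.range W) ∧
      ∀ t : ℝ, ∀ᶠ x in Bornology.cobounded X, ∀ i, x ∈ W i → Metric.ball x t ⊆ U i := by
  rw [isCoarseFamily_range_iff] at hU
  -- `W i` consists of the points whose depth in `U i` is at least half the local Lebesgue number.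
  refine ⟨fun i => {x | ∀ s : ℝ, (∃ j, Metric.ball x (2 * s) ⊆ U j) → Metric.ball x s ⊆ U i},
    isCoarseFamily_range_iff.2 fun t => ?_, fun t => ?_⟩
  · filter_upwards [hU (3 * t)] with x ⟨k, hk⟩
    have : Nonempty ι := ⟨k⟩
    obtain ⟨i, hi⟩ := Finite.exists_max (fun i => Metric.infEDist x (U i)ᶜ)
    have hmax : ∀ j r, Metric.ball x r ⊆ U j → Metric.ball x r ⊆ U i := fun j r h =>
      ball_subset_iff_le_infEDist_compl.2 ((ball_subset_iff_le_infEDist_compl.1 h).trans (hi j))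
    refine ⟨i, fun y hy s ⟨j, hj⟩ => ?_⟩
    rw [Metric.mem_ball] at hy
    -- Here `i` maximizes depth at `x`. For large `s`, `s + t ≤ 2 * s - t`; for small `s`, `s + t ≤
    -- 3 * t`.
    rcases le_total (2 * t) s with hs | hs
    · have h1 : Metric.ball x (2 * s - t) ⊆ U j :=
        (Metric.ball_subset_ball' (by rw [dist_comm]; linarith)).trans hj
      exact (Metric.ball_subset_ball' (by linarith)).trans (hmax j _ h1)
    · exact (Metric.ball_subset_ball' (by linarith)).trans (hmax k _ hk)
  · filter_upwards [hU (2 * t)] with x hx i hi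
    exact hi t hx

lemma IsCoarseFamily.restrict {X ι : Type*} [MetricSpace X] {U : ι → Set X}
    (hU : IsCoarseFamily (Set.range U)) (A : Set X) :
    IsCoarseFamily (Set.range fun i => ((↑) ⁻¹' U i : Set A)) := by
  rw [isCoarseFamily_range_iff] at hU ⊢
  intro t
  filter_upwards [eventually_cobounded_subtype (A := A) (hU t)] with a ⟨i, hi⟩
  exact ⟨i, fun b hb => hi hb⟩

/-- In a space of coarse dimension at most `k - 1`, a finite coarse family has a coarse shrinking
of multiplicity at most `k`. -/
lemma exists_shrinking {X ι : Type*} [MetricSpace X] [Finite ι] {k : ℕ}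
    (hX : ∀ 𝒰 : Set (Set X), 𝒰.Finite → IsCoarseFamily 𝒰 →
      ∃ 𝒱 : Set (Set X), IsCoarseRefinement 𝒱 𝒰 ∧ familyMultiplicity 𝒱 ≤ k)
    {U : ι → Set X} (hU : IsCoarseFamily (Set.range U)) :
    ∃ V : ι → Set X, (∀ i, V i ⊆ U i) ∧ IsCoarseFamily (Set.range V) ∧
      ∀ x, {i | x ∈ V i}.encard ≤ k := by
  obtain ⟨𝒱, ⟨hc, href⟩, hm⟩ := hX _ (Set.finite_range U) hU
  have href' : ∀ V : 𝒱, ∃ i, (V : Set X) ⊆ U i := fun V => by simpa using href V V.2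
  choose f hf using href'
  -- Merging all members assigned to the same index cannot raise the multiplicity.
  refine ⟨fun i => ⋃ V : {V : 𝒱 // f V = i}, (V : Set X), fun i => ?_, ?_, fun x => ?_⟩
  · refine Set.iUnion_subset ?_
    rintro ⟨V, rfl⟩
    exact hf V
  · rw [isCoarseFamily_iff] at hc
    refine isCoarseFamily_range_iff.2 fun t => ?_
    filter_upwards [hc t] with x ⟨V, hV, hx⟩
    exact ⟨f ⟨V, hV⟩, hx.trans
      (Set.subset_iUnion (fun V' : {V' : 𝒱 // f V' = f ⟨V, hV⟩} => (V' : Set X)) ⟨⟨V, hV⟩, rfl⟩)⟩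
  · have hsub : {i | x ∈ ⋃ V : {V : 𝒱 // f V = i}, (V : Set X)} ⊆
        f '' ((↑) ⁻¹' {V | V ∈ 𝒱 ∧ x ∈ V}) := by
      intro i hi
      obtain ⟨⟨V, hV⟩, hx⟩ := Set.mem_iUnion.1 hi
      exact ⟨V, ⟨V.2, hx⟩, hV⟩
    calc _ ≤ _ := Set.encard_le_encard hsub
      _ ≤ ((↑) ⁻¹' {V | V ∈ 𝒱 ∧ x ∈ V} : Set 𝒱).encard := Set.encard_image_le _ _
      _ = ((↑) '' ((↑) ⁻¹' {V | V ∈ 𝒱 ∧ x ∈ V} : Set 𝒱) : Set (Set X)).encard :=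
        (Subtype.val_injective.encard_image _).symm
      _ ≤ multiplicityAt 𝒱 x := Set.encard_le_encard (Set.image_preimage_subset _ _)
      _ ≤ k := (le_iSup (multiplicityAt 𝒱) x).trans hm

/-- If the subset `A` has coarse dimension at most `k - 1`, then every finite coarse family in `X`
has a coarse shrinking whose multiplicity at the points of `A` is at most `k`. -/
lemma exists_shrinking_on {X ι : Type*} [MetricSpace X] [Finite ι] {A : Set X} {k : ℕ}
    (hA : ∀ 𝒰 : Set (Set A), 𝒰.Finite → IsCoarseFamily 𝒰 →
      ∃ 𝒱 : Set (Set A), IsCoarseRefinement 𝒱 𝒰 ∧ familyMultiplicity 𝒱 ≤ k)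
    {U : ι → Set X} (hU : IsCoarseFamily (Set.range U)) :
    ∃ W : ι → Set X, (∀ i, W i ⊆ U i) ∧ IsCoarseFamily (Set.range W) ∧
      ∀ x ∈ A, {i | x ∈ W i}.encard ≤ k := by
  obtain ⟨U', hU', hdeep⟩ := exists_deep_shrinking hU
  obtain ⟨V, hVU, hV, hm⟩ := exists_shrinking hA (hU'.restrict A)
  -- Only the points of `A` outside `V i` are removed from `U i`. A ball missing `A` is unaffected.
  -- A ball near `a ∈ A` is handled by depth: `a ∈ V i ⊆ U' i` puts the whole ball in `U i`, while
  -- coarseness of `V` covers its trace on `A`.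
  refine ⟨fun i => U i ∩ {x | ∀ h : x ∈ A, (⟨x, h⟩ : A) ∈ V i}, fun i => Set.inter_subset_left,
    ?_, fun x hx => ?_⟩
  · rw [isCoarseFamily_range_iff] at hU hV ⊢
    intro t
    filter_upwards [hU t, eventually_cobounded_of_subtype
      ((eventually_cobounded_subtype (hdeep (2 * t))).and (hV (2 * t))) t] with x ⟨j, hj⟩ hx
    by_cases h : ∃ a : A, dist (a : X) x < t
    · obtain ⟨a, ha⟩ := h
      obtain ⟨hd, i, hi⟩ := hx a ha
      have hsub : Metric.ball x t ⊆ Metric.ball (a : X) (2 * t) :=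
        Metric.ball_subset_ball' (by rw [dist_comm]; linarith)
      have hai : a ∈ V i := hi (Metric.mem_ball_self
        (by linarith [dist_nonneg (x := (a : X)) (y := x)]))
      exact ⟨i, fun y hy => ⟨hd i (hVU i hai) (hsub hy), fun hyA => hi (hsub hy)⟩⟩
    · exact ⟨j, fun y hy => ⟨hj hy, fun hyA => absurd ⟨⟨y, hyA⟩, hy⟩ h⟩⟩
  · exact (Set.encard_le_encard fun i hi => hi.2 hx).trans (hm ⟨x, hx⟩)

lemma HasCoarseDimLE.subset {X : Type*} [MetricSpace X] {n : ℤ} (hX : HasCoarseDimLE X n)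
    (A : Set X) : HasCoarseDimLE A n := by
  obtain ⟨k, hk, hX⟩ := hX
  refine ⟨k, hk, fun 𝒰 hfin hc => ?_⟩
  have hc' : IsCoarseFamily (insert Aᶜ ((fun U : Set A => (↑) '' U ∪ Aᶜ) '' 𝒰)) := by
    rw [isCoarseFamily_iff] at hc ⊢
    intro t
    filter_upwards [eventually_cobounded_of_subtype (hc (2 * t)) t] with x hx
    by_cases h : ∃ a : A, dist (a : X) x < t
    · obtain ⟨a, ha⟩ := h
      obtain ⟨U, hU, hi⟩ := hx a ha
      refine ⟨_, Set.mem_insert_of_mem _ ⟨U, hU, rfl⟩, fun y hy => ?_⟩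
      by_cases hyA : y ∈ A
      · have hsub : Metric.ball x t ⊆ Metric.ball (a : X) (2 * t) :=
          Metric.ball_subset_ball' (by rw [dist_comm]; linarith)
        exact Or.inl ⟨⟨y, hyA⟩, hi (hsub hy), rfl⟩
      · exact Or.inr hyA
    · exact ⟨_, Set.mem_insert _ _, fun y hy hyA => h ⟨⟨y, hyA⟩, hy⟩⟩
  obtain ⟨𝒱, ⟨hV, href⟩, hm⟩ := hX _ ((hfin.image _).insert _) hc'
  -- A member inside `Aᶜ` has empty trace, which need not lie in any element of `𝒰`, so `∅` is
  -- discarded.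
  refine ⟨((fun V : Set X => ((↑) ⁻¹' V : Set A)) '' 𝒱) \ {∅}, ⟨?_, ?_⟩, iSup_le fun a => ?_⟩
  · rw [isCoarseFamily_iff] at hV ⊢
    intro t
    -- A positive radius keeps the chosen trace nonempty.
    filter_upwards [eventually_cobounded_subtype (A := A) (hV (max t 1))] with a ⟨V, hV, hi⟩
    refine ⟨_, ⟨⟨V, hV, rfl⟩, ?_⟩,
      fun b hb => hi (Metric.ball_subset_ball (le_max_left t 1) hb)⟩
    exact Set.Nonempty.ne_empty ⟨a, hi (Metric.mem_ball_self (by positivity))⟩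
  · rintro _ ⟨⟨V, hV, rfl⟩, hne⟩
    obtain ⟨a, ha⟩ := Set.nonempty_iff_ne_empty.2 hne
    obtain ⟨_, rfl | ⟨U, hU, rfl⟩, hVU⟩ := href V hV
    · exact absurd a.2 (hVU ha)
    · refine ⟨U, hU, fun b hb => ?_⟩
      obtain ⟨c, hc, hcb⟩ | h := hVU hb
      · rwa [← Subtype.ext hcb]
      · exact absurd b.2 h
  · refine le_trans ?_ ((le_iSup (multiplicityAt 𝒱) a).trans hm)
    refine (Set.encard_le_encard (t := (fun V : Set X => ((↑) ⁻¹' V : Set A)) ''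
      {V | V ∈ 𝒱 ∧ (a : X) ∈ V}) ?_).trans (Set.encard_image_le _ _)
    rintro _ ⟨⟨⟨V, hV, rfl⟩, -⟩, ha⟩
    exact ⟨V, ⟨hV, ha⟩, rfl⟩

lemma HasCoarseDimLE.union {X : Type*} [MetricSpace X] {A B : Set X} (hAB : A ∪ B = Set.univ)
    {n : ℤ} (hA : HasCoarseDimLE A n) (hB : HasCoarseDimLE B n) : HasCoarseDimLE X n := by
  obtain ⟨k, hk, hA⟩ := hA
  obtain ⟨l, hl, hB⟩ := hB
  obtain rfl : k = l := by omega
  refine ⟨k, hk, fun 𝒰 hfin hc => ?_⟩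
  have : Finite 𝒰 := hfin
  obtain ⟨V, hVU, hV, hVA⟩ := exists_shrinking_on hA (U := ((↑) : 𝒰 → Set X)) (by simpa using hc)
  obtain ⟨W, hWV, hW, hWB⟩ := exists_shrinking_on hB hV
  refine ⟨Set.range W, ⟨hW, ?_⟩, iSup_le fun x => ?_⟩
  · rintro _ ⟨i, rfl⟩
    exact ⟨i, i.2, (hWV i).trans (hVU i)⟩
  · have hle : multiplicityAt (Set.range W) x ≤ {i | x ∈ W i}.encard := by
      refine (Set.encard_le_encard (t := W '' {i | x ∈ W i}) ?_).trans (Set.encard_image_le _ _)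
      rintro _ ⟨⟨i, rfl⟩, hx⟩
      exact ⟨i, hx, rfl⟩
    refine hle.trans ?_
    obtain hx | hx : x ∈ A ∪ B := hAB ▸ Set.mem_univ x
    · exact (Set.encard_le_encard fun i hi => hWV i hi).trans (hVA x hx)
    · exact hWB x hx

lemma HasCoarseDimLE.mono {X : Type*} [MetricSpace X] {m n : ℤ} (h : HasCoarseDimLE X m)
    (hmn : m ≤ n) : HasCoarseDimLE X n := by
  obtain ⟨k, hk, h⟩ := h
  refine ⟨(n + 1).toNat, by omega, fun 𝒰 hfin hc => ?_⟩
  obtain ⟨𝒱, hV, hm⟩ := h 𝒰 hfin hc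
  exact ⟨𝒱, hV, hm.trans (by exact_mod_cast (by omega : k ≤ (n + 1).toNat))⟩

/-- The infimum is attained when it is finite, because admissible dimensions are at least `-1`;
otherwise it is `⊤`. -/
lemma coarseDim_le_iff {X : Type*} [MetricSpace X] {m : ℤ} :
    coarseDim X ≤ m ↔ HasCoarseDimLE X m := by
  unfold coarseDim
  by_cases hne : ∃ n, HasCoarseDimLE X n
  · obtain ⟨n, hn, hmin⟩ := Int.exists_least_of_bdd (P := HasCoarseDimLE X)
      ⟨-1, fun z ⟨k, hk, _⟩ => by omega⟩ hne
    have hleast : IsLeast {d | ∃ n : ℤ, d = (n : WithTop ℤ) ∧ HasCoarseDimLE X n} n := by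
      refine ⟨⟨n, rfl, hn⟩, ?_⟩
      rintro _ ⟨z, rfl, hz⟩
      exact WithTop.coe_le_coe.2 (hmin z hz)
    rw [hleast.csInf_eq, WithTop.coe_le_coe]
    exact ⟨hn.mono, hmin m⟩
  · have hempty : {d | ∃ n : ℤ, d = (n : WithTop ℤ) ∧ HasCoarseDimLE X n} = ∅ :=
      Set.eq_empty_of_forall_notMem fun d ⟨n, _, hn⟩ => hne ⟨n, hn⟩
    rw [hempty, WithTop.sInf_empty]
    simpa using fun h => hne ⟨m, h⟩

end CoarseUnion

theorem mainTheorem8 {X : Type*} [MetricSpace X] (A B : Set X) (hAB : A ∪ B = Set.univ) :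
    CoarseUnion.coarseDim X = max (CoarseUnion.coarseDim A) (CoarseUnion.coarseDim B) := by
  refine eq_of_forall_ge_iff fun c => ?_
  induction c using WithTop.recTopCoe with
  | top => simp
  | coe m =>
    simp only [max_le_iff, CoarseUnion.coarseDim_le_iff]
    exact ⟨fun h => ⟨h.subset A, h.subset B⟩, fun h => h.1.union hAB h.2⟩
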